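/- Let $C$ be a $p\times p$ correlation matrix (symmetric positive semidefinite with unit diagonal), and let $Y_1,Y_2,\ldots$ be i.i.d. $N_p(0,C)$ random vectors with coordinates $Y_i=(Y_{i,1},\ldots,Y_{i,p})^T$. For each $n$, $1\le i\le n$ and $1\le j\le p$, let $R_{i,j}=R^{(n)}_{i,j}$ be the rank of $Y_{i,j}$ among $Y_{1,j},\ldots,Y_{n,j}$, i.e. the number of $k\le n$ with $Y_{k,j}\le Y_{i,j}$, let $\hat Y_{i,j}=\Phi^{-1}\left(\frac{R_{i,j}}{n+1}\right)$, where $\Phi$ is the standard normal distribution function, and let $\hat Y_i=(\hat Y_{i,1},\ldots,\hat Y_{i,p})^T$. Let $A$ be a real $p\times p$ matrix such that $\operatorname{diag}(AC+A^TC)=0$. Then $$\frac{1}{\sqrt n}\sum_{i=1}^n\left(\hat Y_i^TA\hat Y_i-Y_i^TAY_i\right)\to 0\quad\text{in probability as } n\to\infty .$$ -/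

import Mathlib

open MeasureTheory ProbabilityTheory Filter
open scoped Matrix

/-- A real matrix is a correlation matrix if it is symmetric positive semidefinite with unit
diagonal. Singular correlation matrices are allowed. -/
def IsCorrelationMatrix {p : ℕ} (C : Matrix (Fin p) (Fin p) ℝ) : Prop :=
  C.PosSemidef ∧ ∀ j, C j j = 1

/-- `Φ`, the distribution function of the standard normal law `N(0, 1)`. -/
noncomputable def stdNormalCDF (x : ℝ) : ℝ := cdf (gaussianReal 0 1) x

/-- `Φ⁻¹`, the standard normal quantile function `u ↦ inf {x | u ≤ Φ x}`. For `0 < u < 1` it is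
the inverse of the continuous strictly increasing function `Φ`. -/
noncomputable def stdNormalQuantile (u : ℝ) : ℝ := sInf {x : ℝ | u ≤ stdNormalCDF x}

/-- The rank of `x i` among `x 0, …, x (n - 1)`: the number of entries that are at most `x i`.
It takes values in `{1, …, n}`. -/
noncomputable def sampleRank {n : ℕ} (x : Fin n → ℝ) (i : Fin n) : ℕ :=
  (Finset.univ.filter (fun k => x k ≤ x i)).card

/-- The (approximate) normal scores `Ŷ i j = Φ⁻¹ (R i j / (n + 1))` of an `n × p` data matrix,
where `R i j` is the rank of the entry `y i j` within the `j`-th column. -/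
noncomputable def normalScores {n p : ℕ} (y : Matrix (Fin n) (Fin p) ℝ) :
    Matrix (Fin n) (Fin p) ℝ :=
  fun i j => stdNormalQuantile ((sampleRank (fun k => y k j) i : ℝ) / ((n : ℝ) + 1))

/-- The quadratic form `vᵀ A v`. -/
def quadForm {p : ℕ} (A : Matrix (Fin p) (Fin p) ℝ) (v : Fin p → ℝ) : ℝ := v ⬝ᵥ (A *ᵥ v)

/-- The `n × p` data matrix whose rows are the first `n` observations, at the outcome `ω`. -/
def dataMatrix {Ω : Type*} {p : ℕ} (Y : ℕ → Ω → EuclideanSpace ℝ (Fin p)) (n : ℕ) (ω : Ω) :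
    Matrix (Fin n) (Fin p) ℝ :=
  fun i j => Y i ω j

/-- `S_n = n^(-1/2) ∑ i, (Ŷ_iᵀ A Ŷ_i - Y_iᵀ A Y_i)`, from the first `n` observations. -/
noncomputable def scoreQuadDiff {Ω : Type*} {p : ℕ} (A : Matrix (Fin p) (Fin p) ℝ)
    (Y : ℕ → Ω → EuclideanSpace ℝ (Fin p)) (n : ℕ) (ω : Ω) : ℝ :=
  1 / Real.sqrt n *
    ∑ i : Fin n, (quadForm A (normalScores (dataMatrix Y n ω) i) - quadForm A (dataMatrix Y n ω i))

/-! ### The standard normal distribution function -/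

/-! Put `D = Ŷ - Y`. Then `Ŷᵀ A Ŷ - Yᵀ A Y = Dᵀ A D + Dᵀ (A + Aᵀ) Y`, and the two terms are
controlled by the same estimate: in each column `j`, `∑ i, D i j ^ 2` is of order `log n` in
probability.

The quadratic term is at most a constant times the sum of these column errors, and `log n / √n → 0`.
For the cross term, let `W i j` be the `j`-th entry of `(A + Aᵀ) Y_i`. Its covariance with `Y i j`
is the `j`-th diagonal entry of `A C + Aᵀ C`, which is zero. By joint normality the whole column `W
· j` is independent of the column `Y · j`, hence of `D · j`, which is a function of the latter.
Given `Y · j`, the sum `∑ i, D i j * W i j` therefore has mean zero and variance `Var W * ∑ i, D i j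
^ 2`, so it is `o(√n)` in probability.

The column estimate (`setLIntegral_sum_sq_scoreError_le`) has three ingredients. The normal quantile
is Lipschitz in the log-odds, so a squared score error is at most a sum of relative squared errors
in the two tails (`sq_stdNormalQuantile_sub_le`). Given `x i`, the rank minus one is binomial with
success probability `u = Φ (x i)`, and the relative error then has mean at most `1 / u`, up to the
factor `1 / (n + 1)` (`lintegral_sq_div_one_add_hitCount_le`). Finally `∫ φ / Φ` over `(a, ∞)` is
`-log Φ(a)`. This diverges as `a → -∞`, so the sample is truncated to `(a, -a)` with `Φ(a) = 1 / n ^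
2`; this costs probability at most `2 / n` and leaves `2 log n`. -/

lemma continuous_gaussianPDFReal (μ : ℝ) (v : NNReal) : Continuous (gaussianPDFReal μ v) := by
  rw [gaussianPDFReal_def]
  fun_prop

lemma stdNormalCDF_eq_measureReal (x : ℝ) :
    stdNormalCDF x = (gaussianReal 0 1).real (Set.Iic x) :=
  cdf_eq_real _ x

lemma measure_Iic_eq_stdNormalCDF (x : ℝ) :
    gaussianReal 0 1 (Set.Iic x) = ENNReal.ofReal (stdNormalCDF x) :=
  (ofReal_cdf _ x).symm

lemma stdNormalCDF_eq_integral (x : ℝ) :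
    stdNormalCDF x = ∫ t in Set.Iic x, gaussianPDFReal 0 1 t := by
  rw [stdNormalCDF_eq_measureReal, measureReal_def, gaussianReal_apply_eq_integral 0 one_ne_zero,
    ENNReal.toReal_ofReal]
  exact integral_nonneg fun t => gaussianPDFReal_nonneg 0 1 t

lemma hasDerivAt_stdNormalCDF (x : ℝ) :
    HasDerivAt stdNormalCDF (gaussianPDFReal 0 1 x) x := by
  have h : stdNormalCDF = fun y => stdNormalCDF 0 + ∫ t in (0 : ℝ)..y, gaussianPDFReal 0 1 t := by
    funext y
    rw [stdNormalCDF_eq_integral, stdNormalCDF_eq_integral,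
      ← intervalIntegral.integral_Iic_sub_Iic (integrable_gaussianPDFReal 0 1).integrableOn
        (integrable_gaussianPDFReal 0 1).integrableOn]
    ring
  rw [h]
  exact (intervalIntegral.integral_hasDerivAt_right
    (integrable_gaussianPDFReal 0 1).intervalIntegrable
    (stronglyMeasurable_gaussianPDFReal 0 1).stronglyMeasurableAtFilter
    (continuous_gaussianPDFReal 0 1).continuousAt).const_add _

lemma continuous_stdNormalCDF : Continuous stdNormalCDF :=
  continuous_iff_continuousAt.2 fun x => (hasDerivAt_stdNormalCDF x).continuousAt

lemma strictMono_stdNormalCDF : StrictMono stdNormalCDF :=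
  strictMono_of_hasDerivAt_pos hasDerivAt_stdNormalCDF
    fun x => gaussianPDFReal_pos 0 1 x one_ne_zero

lemma stdNormalCDF_pos (x : ℝ) : 0 < stdNormalCDF x :=
  (cdf_nonneg _ (x - 1)).trans_lt (strictMono_stdNormalCDF (by linarith))

lemma stdNormalCDF_lt_one (x : ℝ) : stdNormalCDF x < 1 :=
  (strictMono_stdNormalCDF (show x < x + 1 by linarith)).trans_le (cdf_le_one _ _)

lemma gaussianReal_Ioi_eq (x : ℝ) :
    gaussianReal 0 1 (Set.Ioi x) = ENNReal.ofReal (1 - stdNormalCDF x) := by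
  rw [← Set.compl_Iic, prob_compl_eq_one_sub measurableSet_Iic, measure_Iic_eq_stdNormalCDF,
    ENNReal.ofReal_sub _ (stdNormalCDF_pos x).le, ENNReal.ofReal_one]

lemma stdNormalCDF_neg (x : ℝ) : stdNormalCDF (-x) = 1 - stdNormalCDF x := by
  have h := gaussianReal_Ioi_eq x
  have h1 : gaussianReal 0 1 (Set.Ioi x) = gaussianReal 0 1 (Set.Iic (-x)) := by
    have : NullSingletonClass (gaussianReal 0 1) := nullSingletonClass_gaussianReal one_ne_zero
    have h2 := gaussianReal_map_neg (μ := 0) (v := 1)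
    rw [neg_zero] at h2
    conv_rhs => rw [← h2, Measure.map_apply measurable_neg measurableSet_Iic]
    rw [measure_congr Ioi_ae_eq_Ici]
    simp
  rw [h1, measure_Iic_eq_stdNormalCDF] at h
  exact (ENNReal.ofReal_eq_ofReal_iff (stdNormalCDF_pos _).le
    (by linarith [stdNormalCDF_lt_one x])).1 h

lemma exists_stdNormalCDF_eq {u : ℝ} (h0 : 0 < u) (h1 : u < 1) : ∃ x, stdNormalCDF x = u := by
  obtain ⟨a, ha⟩ := ((tendsto_cdf_atBot (gaussianReal 0 1)).eventually_lt_const h0).exists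
  obtain ⟨b, hb⟩ := ((tendsto_cdf_atTop (gaussianReal 0 1)).eventually_const_lt h1).exists
  exact mem_range_of_exists_le_of_exists_ge continuous_stdNormalCDF ⟨a, ha.le⟩ ⟨b, hb.le⟩

lemma stdNormalQuantile_stdNormalCDF (x : ℝ) : stdNormalQuantile (stdNormalCDF x) = x := by
  have : {y : ℝ | stdNormalCDF x ≤ stdNormalCDF y} = Set.Ici x := by
    ext y
    exact strictMono_stdNormalCDF.le_iff_le
  rw [stdNormalQuantile, this, csInf_Ici]

/-- A Mills-type bound without the factor `1 / x`, so that it holds down to `x = 0`: on the tail,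
the density at `t` is at most `√(2π) φ(x)` times the density at `t + x`, and the shifted density has
total mass one. -/
lemma one_sub_stdNormalCDF_le (x : ℝ) (hx : 0 ≤ x) :
    1 - stdNormalCDF x ≤ √(2 * Real.pi) * gaussianPDFReal 0 1 x := by
  have hi : Integrable (fun t => √(2 * Real.pi) * gaussianPDFReal 0 1 x *
      gaussianPDFReal 0 1 (t + x)) :=
    ((integrable_gaussianPDFReal 0 1).comp_add_right x).const_mul _
  calc 1 - stdNormalCDF x = ∫ t in Set.Iic (-x), gaussianPDFReal 0 1 t := by
        rw [← stdNormalCDF_neg, stdNormalCDF_eq_integral]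
    _ ≤ ∫ t in Set.Iic (-x), √(2 * Real.pi) * gaussianPDFReal 0 1 x *
          gaussianPDFReal 0 1 (t + x) := by
        refine setIntegral_mono_on (integrable_gaussianPDFReal 0 1).integrableOn
          hi.integrableOn measurableSet_Iic fun t ht => ?_
        have hs : 0 < √(2 * Real.pi) := by positivity
        simp only [gaussianPDFReal, NNReal.coe_one, mul_one, sub_zero]
        rw [show √(2 * Real.pi) * ((√(2 * Real.pi))⁻¹ * Real.exp (-x ^ 2 / 2)) *
          ((√(2 * Real.pi))⁻¹ * Real.exp (-(t + x) ^ 2 / 2)) =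
          (√(2 * Real.pi))⁻¹ * (Real.exp (-x ^ 2 / 2) * Real.exp (-(t + x) ^ 2 / 2)) by
            field_simp, ← Real.exp_add]
        gcongr
        -- Comparing exponents requires `x² + (t + x)² ≤ t²`, that is `2x(t + x) ≤ 0`.
        have : t + x ≤ 0 := by linarith [Set.mem_Iic.1 ht]
        nlinarith
    _ ≤ ∫ t, √(2 * Real.pi) * gaussianPDFReal 0 1 x * gaussianPDFReal 0 1 (t + x) :=
        setIntegral_le_integral hi (ae_of_all _ fun t => by
          have := gaussianPDFReal_nonneg 0 1 x
          have := gaussianPDFReal_nonneg 0 1 (t + x)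
          positivity)
    _ = √(2 * Real.pi) * gaussianPDFReal 0 1 x := by
        rw [integral_const_mul, integral_add_right_eq_self (gaussianPDFReal 0 1),
          integral_gaussianPDFReal_eq_one 0 one_ne_zero, mul_one]

lemma stdNormalCDF_le (x : ℝ) (hx : x ≤ 0) :
    stdNormalCDF x ≤ √(2 * Real.pi) * gaussianPDFReal 0 1 x := by
  have h := one_sub_stdNormalCDF_le (-x) (by linarith)
  have h2 : gaussianPDFReal 0 1 (-x) = gaussianPDFReal 0 1 x := by simp [gaussianPDFReal]
  rwa [stdNormalCDF_neg, h2, sub_sub_cancel] at h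

/-- The log-odds of the standard normal distribution function. -/
noncomputable def logitCDF (x : ℝ) : ℝ :=
  Real.log (stdNormalCDF x) - Real.log (1 - stdNormalCDF x)

lemma hasDerivAt_logitCDF (x : ℝ) :
    HasDerivAt logitCDF (gaussianPDFReal 0 1 x / stdNormalCDF x
      + gaussianPDFReal 0 1 x / (1 - stdNormalCDF x)) x := by
  have h := hasDerivAt_stdNormalCDF x
  rw [← sub_neg_eq_add, ← neg_div]
  exact (h.log (stdNormalCDF_pos x).ne').sub
    ((h.const_sub 1).log (sub_pos.2 (stdNormalCDF_lt_one x)).ne')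

/-- On each half-line the tail bound controls one of the two hazard rates from below; the other is
nonnegative. -/
lemma le_deriv_logitCDF (x : ℝ) :
    1 / √(2 * Real.pi) ≤ gaussianPDFReal 0 1 x / stdNormalCDF x
      + gaussianPDFReal 0 1 x / (1 - stdNormalCDF x) := by
  have h0 := stdNormalCDF_pos x
  have h1 := sub_pos.2 (stdNormalCDF_lt_one x)
  have hp := gaussianPDFReal_pos 0 1 x one_ne_zero
  have hs : 0 < √(2 * Real.pi) := by positivity
  rcases le_total x 0 with hx | hx
  · refine le_add_of_le_of_nonneg ?_ (by positivity)
    rw [div_le_div_iff₀ hs h0]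
    linarith [stdNormalCDF_le x hx]
  · refine le_add_of_nonneg_of_le (by positivity) ?_
    rw [div_le_div_iff₀ hs h1]
    linarith [one_sub_stdNormalCDF_le x hx]

lemma sub_le_logitCDF_sub {x y : ℝ} (h : x ≤ y) :
    1 / √(2 * Real.pi) * (y - x) ≤ logitCDF y - logitCDF x := by
  refine Convex.mul_sub_le_image_sub_of_le_deriv convex_univ (f := logitCDF)
    (fun z _ => (hasDerivAt_logitCDF z).continuousAt.continuousWithinAt)
    (fun z _ => (hasDerivAt_logitCDF z).differentiableAt.differentiableWithinAt)
    (fun z _ => ?_) x trivial y trivial h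
  rw [(hasDerivAt_logitCDF z).deriv]
  exact le_deriv_logitCDF z

/-- This is `s ≤ sinh s` at `s = (log b - log a) / 2`. The geometric mean in the denominator puts
both the true and the empirical probability there, so that one can be averaged out before the other.
-/
lemma log_div_le {a b : ℝ} (ha : 0 < a) (hab : a ≤ b) :
    Real.log b - Real.log a ≤ (b - a) / √(a * b) := by
  have hb := ha.trans_le hab
  have h := Real.self_le_sinh_iff.2
    (div_nonneg (sub_nonneg.2 (Real.log_le_log ha hab)) two_pos.le)
  rw [Real.sinh_eq, ← neg_div, neg_sub, sub_div, sub_div (Real.log a), sub_div, Real.exp_sub,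
    Real.exp_sub, Real.exp_half, Real.exp_half, Real.exp_log ha, Real.exp_log hb] at h
  have h2 : √b / √a - √a / √b = (b - a) / √(a * b) := by
    rw [Real.sqrt_mul ha.le, div_sub_div _ _ (by positivity) (by positivity),
      Real.mul_self_sqrt ha.le, Real.mul_self_sqrt hb.le]
  linarith

lemma sq_log_sub_le {a b : ℝ} (ha : 0 < a) (hb : 0 < b) :
    (Real.log b - Real.log a) ^ 2 ≤ (b - a) ^ 2 / (a * b) := by
  wlog h : a ≤ b generalizing a b
  · have := this hb ha (le_of_not_ge h)
    rwa [mul_comm, sub_sq_comm, sub_sq_comm a b] at this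
  · calc (Real.log b - Real.log a) ^ 2 ≤ ((b - a) / √(a * b)) ^ 2 := by
          gcongr
          · exact sub_nonneg.2 (Real.log_le_log ha h)
          · exact log_div_le ha h
      _ = (b - a) ^ 2 / (a * b) := by
          rw [div_pow, Real.sq_sqrt (by positivity)]

/-- The standard normal quantile function is Lipschitz as a function of the log-odds. -/
lemma sq_stdNormalQuantile_sub_le {v : ℝ} (hv : 0 < v) (hv1 : v < 1) (x : ℝ) :
    (stdNormalQuantile v - x) ^ 2 ≤ 4 * Real.pi * ((v - stdNormalCDF x) ^ 2 / (stdNormalCDF x * v)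
      + (v - stdNormalCDF x) ^ 2 / ((1 - stdNormalCDF x) * (1 - v))) := by
  obtain ⟨y, rfl⟩ := exists_stdNormalCDF_eq hv hv1
  rw [stdNormalQuantile_stdNormalCDF]
  have key : ∀ a b : ℝ, a ≤ b → (b - a) ^ 2 ≤ 2 * Real.pi * (logitCDF b - logitCDF a) ^ 2 := by
    intro a b hab
    have h := pow_le_pow_left₀ (by have := sub_nonneg.2 hab; positivity) (sub_le_logitCDF_sub hab) 2
    rw [mul_pow, div_pow, Real.sq_sqrt (by positivity), one_pow, div_mul_eq_mul_div, one_mul,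
      div_le_iff₀ (by positivity)] at h
    linarith
  have h1 : (y - x) ^ 2 ≤ 2 * Real.pi * (logitCDF y - logitCDF x) ^ 2 := by
    rcases le_total x y with h | h
    · exact key x y h
    · have := key y x h
      rwa [sub_sq_comm, sub_sq_comm (logitCDF x)] at this
  have h2 := sq_log_sub_le (stdNormalCDF_pos x) hv
  have h3 := sq_log_sub_le (sub_pos.2 (stdNormalCDF_lt_one x)) (sub_pos.2 hv1)
  rw [sub_sub_sub_cancel_left, sub_sq_comm (stdNormalCDF x)] at h3
  have h4 : (logitCDF y - logitCDF x) ^ 2 ≤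
      2 * ((Real.log (stdNormalCDF y) - Real.log (stdNormalCDF x)) ^ 2 +
        (Real.log (1 - stdNormalCDF y) - Real.log (1 - stdNormalCDF x)) ^ 2) := by
    unfold logitCDF
    nlinarith [sq_nonneg (Real.log (stdNormalCDF y) - Real.log (stdNormalCDF x) +
      (Real.log (1 - stdNormalCDF y) - Real.log (1 - stdNormalCDF x)))]
  calc (y - x) ^ 2 ≤ 2 * Real.pi * (logitCDF y - logitCDF x) ^ 2 := h1
    _ ≤ 2 * Real.pi * (2 * ((stdNormalCDF y - stdNormalCDF x) ^ 2 /
          (stdNormalCDF x * stdNormalCDF y) + (stdNormalCDF y - stdNormalCDF x) ^ 2 /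
          ((1 - stdNormalCDF x) * (1 - stdNormalCDF y)))) := by
        gcongr
        linarith
    _ = _ := by ring

/-- The integrand against Lebesgue measure is `φ / Φ`, the derivative of `log Φ`, which vanishes at
infinity. -/
lemma lintegral_inv_stdNormalCDF_le (a : ℝ) :
    ∫⁻ x in Set.Ioi a, ENNReal.ofReal (1 / stdNormalCDF x) ∂gaussianReal 0 1
      ≤ ENNReal.ofReal (-Real.log (stdNormalCDF a)) := by
  have hd : ∀ x, HasDerivAt (fun y => Real.log (stdNormalCDF y))
      (gaussianPDFReal 0 1 x / stdNormalCDF x) x :=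
    fun x => (hasDerivAt_stdNormalCDF x).log (stdNormalCDF_pos x).ne'
  have hlim : Tendsto (fun y => Real.log (stdNormalCDF y)) atTop (nhds 0) := by
    have := (Real.continuousAt_log one_ne_zero).tendsto.comp
      (tendsto_cdf_atTop (gaussianReal 0 1))
    rwa [Real.log_one] at this
  have hnn : ∀ x, 0 ≤ gaussianPDFReal 0 1 x / stdNormalCDF x := fun x =>
    div_nonneg (gaussianPDFReal_nonneg 0 1 x) (stdNormalCDF_pos x).le
  have hint := integral_Ioi_of_hasDerivAt_of_nonneg' (a := a) (fun x _ => hd x)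
    (fun x _ => hnn x) hlim
  have hI := integrableOn_Ioi_deriv_of_nonneg' (a := a) (fun x _ => hd x)
    (fun x _ => hnn x) hlim
  rw [gaussianReal_of_var_ne_zero 0 one_ne_zero,
    setLIntegral_withDensity_eq_setLIntegral_mul _ (measurable_gaussianPDF 0 1) _
      measurableSet_Ioi]
  · rw [← zero_sub, ← hint, ofReal_integral_eq_lintegral_ofReal hI
      (ae_of_all _ hnn)]
    refine le_of_eq (lintegral_congr fun x => ?_)
    rw [Pi.mul_apply, gaussianPDF, ← ENNReal.ofReal_mul (gaussianPDFReal_nonneg 0 1 x)]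
    congr 1
    ring
  · exact (measurable_const.div continuous_stdNormalCDF.measurable).ennreal_ofReal

lemma lintegral_inv_one_sub_stdNormalCDF_le (a : ℝ) :
    ∫⁻ x in Set.Iio (-a), ENNReal.ofReal (1 / (1 - stdNormalCDF x)) ∂gaussianReal 0 1
      ≤ ENNReal.ofReal (-Real.log (stdNormalCDF a)) := by
  have h : MeasurePreserving (fun x : ℝ => -x) (gaussianReal 0 1) (gaussianReal 0 1) :=
    ⟨measurable_neg, by simpa using gaussianReal_map_neg (μ := 0) (v := 1)⟩
  refine le_trans (le_of_eq ?_) (lintegral_inv_stdNormalCDF_le a)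
  have := h.setLIntegral_comp_preimage (s := Set.Ioi a) measurableSet_Ioi
    (f := fun x => ENNReal.ofReal (1 / stdNormalCDF x))
    (measurable_const.div continuous_stdNormalCDF.measurable).ennreal_ofReal
  rw [← this]
  simp [stdNormalCDF_neg]

/-! ### Counting hits of a set by an independent sample -/

/-- The number of entries of `x` that lie in `s`, as a real number. -/
noncomputable def hitCount {E : Type*} {m : ℕ} (s : Set E) (x : Fin m → E) : ℝ :=
  ∑ k, s.indicator (fun _ => (1 : ℝ)) (x k)

section hitCount

variable {E : Type*} {m : ℕ}

lemma hitCount_nonneg (s : Set E) (x : Fin m → E) : 0 ≤ hitCount s x :=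
  Finset.sum_nonneg fun _ _ => Set.indicator_nonneg (fun _ _ => zero_le_one) _

lemma hitCount_le (s : Set E) (x : Fin m → E) : hitCount s x ≤ m := by
  refine (Finset.sum_le_card_nsmul _ _ 1 fun k _ => ?_).trans (by simp)
  exact Set.indicator_le_self' (fun _ _ => zero_le_one) _

lemma hitCount_succAbove (s : Set E) (x : Fin (m + 1) → E) (i : Fin (m + 1)) :
    hitCount s x = s.indicator (fun _ => (1 : ℝ)) (x i) + hitCount s (i.removeNth x) :=
  Fin.sum_univ_succAbove _ i

/-- For an entry in `s`, one plus the hits among the others is the total count. The sum is thus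
count over count: one, or zero if nothing hits. -/
lemma sum_indicator_div_le_one (s : Set E) (x : Fin (m + 1) → E) :
    ∑ k, s.indicator (fun _ => (1 : ℝ)) (x k) * (1 + hitCount s (k.removeNth x))⁻¹ ≤ 1 := by
  calc ∑ k, s.indicator (fun _ => (1 : ℝ)) (x k) * (1 + hitCount s (k.removeNth x))⁻¹
      = ∑ k, s.indicator (fun _ => (1 : ℝ)) (x k) * (hitCount s x)⁻¹ := by
        refine Finset.sum_congr rfl fun k _ => ?_
        by_cases h : x k ∈ s
        · rw [hitCount_succAbove s x k, Set.indicator_of_mem h]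
        · rw [Set.indicator_of_notMem h, zero_mul, zero_mul]
    _ = hitCount s x * (hitCount s x)⁻¹ := by rw [← Finset.sum_mul, hitCount]
    _ ≤ 1 := mul_inv_le_one

/-- After this division only the means of the count and of `(1 + count)⁻¹` are needed. -/
lemma sq_div_one_add_hitCount (s : Set E) (x : Fin m → E) (a : ℝ) :
    (1 + hitCount s x - a) ^ 2 / (1 + hitCount s x) =
      (1 - 2 * a + hitCount s x) + a ^ 2 * (1 + hitCount s x)⁻¹ := by
  have := hitCount_nonneg s x
  field_simp
  ring

variable [MeasurableSpace E]

lemma measurable_hitCount_uncurry {F : Type*} [MeasurableSpace F] {S : F → Set E}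
    (hS : MeasurableSet {q : F × E | q.2 ∈ S q.1}) :
    Measurable fun q : F × (Fin m → E) => hitCount (S q.1) q.2 := by
  refine Finset.measurable_sum _ fun k _ => ?_
  have h : Measurable fun q : F × (Fin m → E) => (q.1, q.2 k) := by fun_prop
  exact (measurable_const.indicator hS).comp h

lemma measurable_hitCount {s : Set E} (hs : MeasurableSet s) :
    Measurable (hitCount s : (Fin m → E) → ℝ) :=
  Finset.measurable_sum _ fun k _ => (measurable_const.indicator hs).comp (measurable_pi_apply k)

variable (ν : Measure E) [IsProbabilityMeasure ν]

lemma integrable_hitCount {s : Set E} (hs : MeasurableSet s) :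
    Integrable (hitCount s) (Measure.pi fun _ : Fin m => ν) :=
  Integrable.of_bound (measurable_hitCount hs).aestronglyMeasurable m
    (ae_of_all _ fun x => by
      rw [Real.norm_of_nonneg (hitCount_nonneg s x)]
      exact hitCount_le s x)

lemma integral_hitCount {s : Set E} (hs : MeasurableSet s) :
    ∫ x, hitCount s x ∂(Measure.pi fun _ : Fin m => ν) = m * ν.real s := by
  unfold hitCount
  rw [integral_finsetSum]
  · have : ∀ k : Fin m, ∫ x, s.indicator (fun _ => (1 : ℝ)) (x k)
        ∂(Measure.pi fun _ : Fin m => ν) = ν.real s := fun k => by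
      rw [← integral_indicator_one hs]
      exact (measurePreserving_eval (fun _ : Fin m => ν) k).hasLaw.integral_comp
        (f := s.indicator 1) (measurable_const.indicator hs).aestronglyMeasurable
    simp [this]
  · refine fun k _ => Integrable.of_bound (C := 1)
      ((measurable_const.indicator hs).comp (measurable_pi_apply k)).aestronglyMeasurable
      (ae_of_all _ fun x => ?_)
    exact (norm_indicator_le_norm_self _ _).trans (by simp)

lemma integrable_inv_one_add_hitCount {s : Set E} (hs : MeasurableSet s) :
    Integrable (fun x => (1 + hitCount s x)⁻¹) (Measure.pi fun _ : Fin m => ν) :=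
  Integrable.of_bound (((measurable_hitCount hs).const_add 1).inv).aestronglyMeasurable 1
    (ae_of_all _ fun x => by
      have := hitCount_nonneg s x
      rw [Real.norm_of_nonneg (by positivity)]
      exact inv_le_one_of_one_le₀ (by linarith))

/-- Exchangeability replaces the binomial sum: add one observation to the sample. The `m + 1`
summands of `sum_indicator_div_le_one` all have the same expectation, by independence `ν s` times
the integral. -/
lemma measure_mul_integral_inv_le {s : Set E} (hs : MeasurableSet s) :
    (m + 1) * (ν.real s * ∫ x, (1 + hitCount s x)⁻¹ ∂(Measure.pi fun _ : Fin m => ν)) ≤ 1 := by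
  have hmp (k : Fin (m + 1)) := measurePreserving_piFinSuccAbove (fun _ : Fin (m + 1) => ν) k
  have hi : Integrable (s.indicator fun _ => (1 : ℝ)) ν := (integrable_const 1).indicator hs
  have hI : ∀ k : Fin (m + 1), Integrable (fun x : Fin (m + 1) → E =>
      s.indicator (fun _ => (1 : ℝ)) (x k) * (1 + hitCount s (k.removeNth x))⁻¹)
      (Measure.pi fun _ => ν) := fun k =>
    (hmp k).integrable_comp_of_integrable
      (hi.mul_prod (integrable_inv_one_add_hitCount ν hs))
  have h : ∀ k : Fin (m + 1), ∫ x : Fin (m + 1) → E,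
      s.indicator (fun _ => (1 : ℝ)) (x k) * (1 + hitCount s (k.removeNth x))⁻¹
      ∂(Measure.pi fun _ => ν)
      = ν.real s * ∫ x, (1 + hitCount s x)⁻¹ ∂(Measure.pi fun _ : Fin m => ν) := fun k => by
    rw [← integral_indicator_one hs]
    refine Eq.trans ?_ (integral_prod_mul (μ := ν) (ν := Measure.pi fun _ : Fin m => ν)
      (s.indicator fun _ => (1 : ℝ)) fun x => (1 + hitCount s x)⁻¹)
    exact (hmp k).integral_comp' (g := fun q : E × (Fin m → E) =>
      s.indicator (fun _ => (1 : ℝ)) q.1 * (1 + hitCount s q.2)⁻¹)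
  calc (m + 1) * (ν.real s * ∫ x, (1 + hitCount s x)⁻¹ ∂(Measure.pi fun _ : Fin m => ν))
      = ∫ x : Fin (m + 1) → E, ∑ k, s.indicator (fun _ => (1 : ℝ)) (x k) *
          (1 + hitCount s (k.removeNth x))⁻¹ ∂(Measure.pi fun _ => ν) := by
        rw [integral_finsetSum _ fun k _ => hI k]
        simp [h]
    _ ≤ ∫ _ : Fin (m + 1) → E, (1 : ℝ) ∂(Measure.pi fun _ => ν) :=
        integral_mono (integrable_finsetSum _ fun k _ => hI k) (integrable_const 1)
          fun x => sum_indicator_div_le_one s x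
    _ = 1 := by simp

lemma integrable_sq_div_one_add_hitCount {s : Set E} (hs : MeasurableSet s) (a : ℝ) :
    Integrable (fun x => (1 + hitCount s x - a) ^ 2 / (1 + hitCount s x))
      (Measure.pi fun _ : Fin m => ν) := by
  simp_rw [sq_div_one_add_hitCount]
  exact ((integrable_const _).add (integrable_hitCount ν hs)).add
    ((integrable_inv_one_add_hitCount ν hs).const_mul _)

lemma integral_sq_div_one_add_hitCount_le {s : Set E} (hs : MeasurableSet s) :
    ∫ x, (1 + hitCount s x - (m + 2) * ν.real s) ^ 2 / (1 + hitCount s x)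
      ∂(Measure.pi fun _ : Fin m => ν) ≤ 1 := by
  simp_rw [sq_div_one_add_hitCount]
  rw [integral_add (f := fun x => 1 - 2 * ((m + 2) * ν.real s) + hitCount s x)
    ((integrable_const _).add (integrable_hitCount ν hs)) ((integrable_inv_one_add_hitCount ν hs).const_mul _),
    integral_add (integrable_const _) (integrable_hitCount ν hs), integral_const_mul,
    integral_hitCount ν hs]
  have h := measure_mul_integral_inv_le (m := m) ν hs
  set I := ∫ x, (1 + hitCount s x)⁻¹ ∂(Measure.pi fun _ : Fin m => ν)
  have hu : 0 ≤ ν.real s := measureReal_nonneg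
  set u := ν.real s
  simp only [integral_const, probReal_univ, one_smul]
  have hm : (0 : ℝ) ≤ m := Nat.cast_nonneg m
  have h1 : u * I ≤ 1 / (m + 1) := by
    rw [le_div_iff₀ (by positivity)]
    linarith
  have h2 : ((m + 2) * u) ^ 2 * I ≤ (m + 2) ^ 2 * u * (1 / (m + 1)) := by
    calc ((m + 2) * u) ^ 2 * I = (m + 2) ^ 2 * u * (u * I) := by ring
      _ ≤ _ := by gcongr
  -- Uses `(m + 2)² ≤ (m + 4)(m + 1)`. The terms linear in `u` then cancel exactly: `-2(m + 2) + m +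
  -- (m + 4) = 0`.
  have h3 : ((m : ℝ) + 2) ^ 2 * u * (1 / (m + 1)) ≤ (m + 4) * u := by
    rw [mul_one_div, div_le_iff₀ (by positivity)]
    nlinarith [mul_nonneg hm hu]
  linarith

/-- The mean relative squared deviation of a count in a sample from its conditional expectation
given one of the observations. -/
lemma lintegral_sq_div_one_add_hitCount_le {S : E → Set E}
    (hS : MeasurableSet {q : E × E | q.2 ∈ S q.1}) (hg : Measurable fun a => ν.real (S a))
    {T : Set E} (hT : MeasurableSet T) (i : Fin (m + 1)) :
    ∫⁻ x : Fin (m + 1) → E, T.indicator (fun a => ENNReal.ofReal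
        ((1 + hitCount (S a) (i.removeNth x) - (m + 2) * ν.real (S a)) ^ 2 /
          (ν.real (S a) * (1 + hitCount (S a) (i.removeNth x))))) (x i)
        ∂(Measure.pi fun _ => ν)
      ≤ ∫⁻ a in T, ENNReal.ofReal (1 / ν.real (S a)) ∂ν := by
  have hSa : ∀ a, MeasurableSet (S a) := fun a => hS.preimage measurable_prodMk_left
  let f : E × (Fin m → E) → ENNReal := fun q => ENNReal.ofReal
    ((1 + hitCount (S q.1) q.2 - (m + 2) * ν.real (S q.1)) ^ 2 /
      (ν.real (S q.1) * (1 + hitCount (S q.1) q.2)))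
  have hK := measurable_hitCount_uncurry (m := m) hS
  have hg' : Measurable fun q : E × (Fin m → E) => ν.real (S q.1) := hg.comp measurable_fst
  have hf : Measurable f := by fun_prop
  have hF : Measurable (({q : E × (Fin m → E) | q.1 ∈ T}).indicator f) :=
    hf.indicator (hT.preimage measurable_fst)
  calc _ = ∫⁻ x : Fin (m + 1) → E, ({q : E × (Fin m → E) | q.1 ∈ T}).indicator f
          (MeasurableEquiv.piFinSuccAbove (fun _ => E) i x) ∂(Measure.pi fun _ => ν) := by
        refine lintegral_congr fun x => ?_
        by_cases h : x i ∈ T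
        · rw [Set.indicator_of_mem h, Set.indicator_of_mem (by exact h)]
          rfl
        · rw [Set.indicator_of_notMem h, Set.indicator_of_notMem (by exact h)]
    -- Splitting off the `i`-th observation makes it independent of the remaining `m`; Fubini then
    -- amounts to conditioning on it.
    _ = ∫⁻ q, ({q : E × (Fin m → E) | q.1 ∈ T}).indicator f q
          ∂(ν.prod (Measure.pi fun _ : Fin m => ν)) :=
        (measurePreserving_piFinSuccAbove (fun _ : Fin (m + 1) => ν) i).lintegral_comp hF
    _ = ∫⁻ a, ∫⁻ x, ({q : E × (Fin m → E) | q.1 ∈ T}).indicator f (a, x)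
          ∂(Measure.pi fun _ : Fin m => ν) ∂ν := lintegral_prod _ hF.aemeasurable
    _ ≤ ∫⁻ a, T.indicator (fun a => ENNReal.ofReal (1 / ν.real (S a))) a ∂ν := by
        refine lintegral_mono fun a => ?_
        by_cases ha : a ∈ T
        · rw [Set.indicator_of_mem ha]
          have hu : 0 ≤ 1 / ν.real (S a) := div_nonneg zero_le_one measureReal_nonneg
          calc _ = ∫⁻ x, ENNReal.ofReal (1 / ν.real (S a)) * ENNReal.ofReal
                  ((1 + hitCount (S a) x - (m + 2) * ν.real (S a)) ^ 2 / (1 + hitCount (S a) x))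
                  ∂(Measure.pi fun _ : Fin m => ν) := by
                refine lintegral_congr fun x => ?_
                rw [Set.indicator_of_mem (by exact ha), ← ENNReal.ofReal_mul hu, div_mul_div_comm, one_mul]
            _ = ENNReal.ofReal (1 / ν.real (S a)) * ENNReal.ofReal
                  (∫ x, (1 + hitCount (S a) x - (m + 2) * ν.real (S a)) ^ 2 /
                    (1 + hitCount (S a) x) ∂(Measure.pi fun _ : Fin m => ν)) := by
                rw [lintegral_const_mul' _ _ ENNReal.ofReal_ne_top,
                  ofReal_integral_eq_lintegral_ofReal
                    (integrable_sq_div_one_add_hitCount ν (hSa a) _)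
                    (ae_of_all _ fun x => div_nonneg (sq_nonneg _)
                      (by have := hitCount_nonneg (S a) x; positivity))]
            _ ≤ ENNReal.ofReal (1 / ν.real (S a)) * 1 := by
                gcongr
                exact ENNReal.ofReal_le_one.2 (integral_sq_div_one_add_hitCount_le ν (hSa a))
            _ = _ := mul_one _
        · simp [ha]
    _ = ∫⁻ a in T, ENNReal.ofReal (1 / ν.real (S a)) ∂ν := lintegral_indicator hT _

end hitCount

/-! ### Normal scores of a standard normal sample -/

lemma sampleRank_eq_hitCount {n : ℕ} (x : Fin n → ℝ) (i : Fin n) :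
    (sampleRank x i : ℝ) = hitCount (Set.Iic (x i)) x := by
  classical
  simp [sampleRank, hitCount, Set.indicator_apply]

lemma hitCount_Iic_add_hitCount_Ioi {n : ℕ} (x : Fin n → ℝ) (a : ℝ) :
    hitCount (Set.Iic a) x + hitCount (Set.Ioi a) x = n := by
  rw [hitCount, hitCount, ← Finset.sum_add_distrib]
  have : ∀ k, (Set.Iic a).indicator (fun _ => (1 : ℝ)) (x k) +
      (Set.Ioi a).indicator (fun _ => (1 : ℝ)) (x k) = 1 := fun k => by
    rw [← Set.compl_Iic, Set.indicator_self_add_compl_apply]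
  simp [this]

lemma sampleRank_eq_one_add {m : ℕ} (x : Fin (m + 1) → ℝ) (i : Fin (m + 1)) :
    (sampleRank x i : ℝ) = 1 + hitCount (Set.Iic (x i)) (i.removeNth x) := by
  rw [sampleRank_eq_hitCount, hitCount_succAbove _ x i, Set.indicator_of_mem (Set.mem_Iic.2 le_rfl)]

/-- With `n + 1 = m + 2` in the denominator of the scores, the upper tail has the same form as the
lower one, so one binomial estimate serves both. Ties do no harm, since `Iic` and `Ioi` are
complementary. -/
lemma sub_sampleRank_eq_one_add {m : ℕ} (x : Fin (m + 1) → ℝ) (i : Fin (m + 1)) :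
    (m + 2 : ℝ) - sampleRank x i = 1 + hitCount (Set.Ioi (x i)) (i.removeNth x) := by
  have := hitCount_Iic_add_hitCount_Ioi (i.removeNth x) (x i)
  rw [sampleRank_eq_one_add]
  linarith

/-- The deviation of the `i`-th normal score of a sample from the `i`-th observation. -/
noncomputable def scoreError {n : ℕ} (x : Fin n → ℝ) (i : Fin n) : ℝ :=
  stdNormalQuantile ((sampleRank x i : ℝ) / ((n : ℝ) + 1)) - x i

lemma measurable_sampleRank {n : ℕ} (i : Fin n) :
    Measurable fun x : Fin n → ℝ => sampleRank x i := by
  simp only [sampleRank, Finset.card_filter]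
  refine Finset.measurable_sum _ fun k _ => ?_
  exact Measurable.ite (measurableSet_le (measurable_pi_apply k) (measurable_pi_apply i))
    measurable_const measurable_const

@[fun_prop]
lemma measurable_scoreError {n : ℕ} (i : Fin n) :
    Measurable fun x : Fin n → ℝ => scoreError x i := by
  -- The rank is a natural number, so no measurability of the quantile function is needed.
  have h : Measurable fun r : ℕ => stdNormalQuantile ((r : ℝ) / ((n : ℝ) + 1)) :=
    measurable_from_nat
  exact (h.comp (measurable_sampleRank i)).sub (measurable_pi_apply i)

lemma sq_scoreError_le {m : ℕ} (x : Fin (m + 1) → ℝ) (i : Fin (m + 1)) :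
    scoreError x i ^ 2 ≤ 4 * Real.pi / (m + 2) *
      ((1 + hitCount (Set.Iic (x i)) (i.removeNth x) - (m + 2) * stdNormalCDF (x i)) ^ 2 /
          (stdNormalCDF (x i) * (1 + hitCount (Set.Iic (x i)) (i.removeNth x))) +
        (1 + hitCount (Set.Ioi (x i)) (i.removeNth x) - (m + 2) * (1 - stdNormalCDF (x i))) ^ 2 /
          ((1 - stdNormalCDF (x i)) * (1 + hitCount (Set.Ioi (x i)) (i.removeNth x)))) := by
  have hm : (0 : ℝ) < m + 2 := by positivity
  have h1 := hitCount_nonneg (Set.Iic (x i)) (i.removeNth x)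
  have h2 := hitCount_nonneg (Set.Ioi (x i)) (i.removeNth x)
  have hr := sampleRank_eq_one_add x i
  have hr' := sub_sampleRank_eq_one_add x i
  rw [← hr, ← hr']
  have h0 : (0 : ℝ) < sampleRank x i := by linarith
  have h0' : (0 : ℝ) < m + 2 - sampleRank x i := by linarith
  have hΦ := stdNormalCDF_pos (x i)
  have hΦ' := sub_pos.2 (stdNormalCDF_lt_one (x i))
  have h := sq_stdNormalQuantile_sub_le (v := sampleRank x i / (m + 2)) (by positivity)
    ((div_lt_one hm).2 (by linarith)) (x i)
  have e : ((m + 1 : ℕ) : ℝ) + 1 = m + 2 := by push_cast; ring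
  rw [scoreError, e]
  refine h.trans (le_of_eq ?_)
  have e1 : 1 - (sampleRank x i : ℝ) / (m + 2) = (m + 2 - sampleRank x i) / (m + 2) := by
    field_simp
  rw [e1]
  generalize (sampleRank x i : ℝ) = r at *
  generalize stdNormalCDF (x i) = u at *
  field_simp
  ring

lemma measureReal_Iic_gaussianReal (a : ℝ) :
    (gaussianReal 0 1).real (Set.Iic a) = stdNormalCDF a :=
  (stdNormalCDF_eq_measureReal a).symm

lemma measureReal_Ioi_gaussianReal (a : ℝ) :
    (gaussianReal 0 1).real (Set.Ioi a) = 1 - stdNormalCDF a := by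
  rw [measureReal_def, gaussianReal_Ioi_eq,
    ENNReal.toReal_ofReal (sub_nonneg.2 (stdNormalCDF_lt_one a).le)]

/-- The samples all of whose entries lie in `(a, -a)`. -/
def boundedSamples (n : ℕ) (a : ℝ) : Set (Fin n → ℝ) := {x | ∀ i, x i ∈ Set.Ioo a (-a)}

lemma measurableSet_boundedSamples (n : ℕ) (a : ℝ) : MeasurableSet (boundedSamples n a) := by
  have : boundedSamples n a = Set.univ.pi fun _ => Set.Ioo a (-a) := by
    ext
    simp [boundedSamples]
  rw [this]
  exact MeasurableSet.univ_pi fun _ => measurableSet_Ioo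

lemma measure_compl_boundedSamples_le (n : ℕ) (a : ℝ) :
    Measure.pi (fun _ : Fin n => gaussianReal 0 1) (boundedSamples n a)ᶜ
      ≤ ENNReal.ofReal (n * (2 * stdNormalCDF a)) := by
  have : NullSingletonClass (gaussianReal 0 1) := nullSingletonClass_gaussianReal one_ne_zero
  have hΦ := stdNormalCDF_pos a
  have hsub : (boundedSamples n a)ᶜ ⊆
      ⋃ i : Fin n, (fun x : Fin n → ℝ => x i) ⁻¹' (Set.Iic a ∪ Set.Ici (-a)) := by
    intro x hx
    simp only [boundedSamples, Set.mem_compl_iff, Set.mem_ofPred_eq, not_forall, Set.mem_Ioo,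
      not_and_or, not_lt] at hx
    simpa using hx
  have hone : ∀ i : Fin n, Measure.pi (fun _ : Fin n => gaussianReal 0 1)
      ((fun x : Fin n → ℝ => x i) ⁻¹' (Set.Iic a ∪ Set.Ici (-a)))
      ≤ ENNReal.ofReal (2 * stdNormalCDF a) := fun i => by
    have hms : MeasurableSet (Set.Iic a ∪ Set.Ici (-a)) := measurableSet_Iic.union measurableSet_Ici
    have := (measurePreserving_eval (fun _ : Fin n => gaussianReal 0 1) i).measure_preimage
      hms.nullMeasurableSet
    refine (le_of_eq this).trans ((measure_union_le _ _).trans (le_of_eq ?_))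
    rw [measure_Iic_eq_stdNormalCDF, ← measure_congr Ioi_ae_eq_Ici, gaussianReal_Ioi_eq,
      stdNormalCDF_neg, sub_sub_cancel, ← ENNReal.ofReal_add hΦ.le hΦ.le, two_mul]
  calc _ ≤ _ := measure_mono hsub
    _ ≤ ∑ i : Fin n, _ := measure_iUnion_fintype_le _ _
    _ ≤ ∑ _i : Fin n, ENNReal.ofReal (2 * stdNormalCDF a) := Finset.sum_le_sum fun i _ => hone i
    _ = _ := by
      rw [Finset.sum_const, Finset.card_univ, Fintype.card_fin, nsmul_eq_mul,
        ENNReal.ofReal_mul (Nat.cast_nonneg n), ENNReal.ofReal_natCast]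

/-- The squared deviation of `1 + hitCount s x` from `(m + 2) * u`, relative to both numbers. -/
noncomputable def hitDeviation {E : Type*} {m : ℕ} (s : Set E) (u : ℝ) (x : Fin m → E) : ℝ :=
  (1 + hitCount s x - (m + 2) * u) ^ 2 / (u * (1 + hitCount s x))

lemma measurable_indicator_hitDeviation {m : ℕ} {S : ℝ → Set ℝ}
    (hS : MeasurableSet {q : ℝ × ℝ | q.2 ∈ S q.1}) {g : ℝ → ℝ} (hg : Measurable g) {T : Set ℝ}
    (hT : MeasurableSet T) (i : Fin (m + 1)) :
    Measurable fun x : Fin (m + 1) → ℝ => T.indicator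
      (fun a => ENNReal.ofReal (hitDeviation (S a) (g a) (i.removeNth x))) (x i) := by
  have hr : Measurable fun x : Fin (m + 1) → ℝ => (x i, i.removeNth x) :=
    (measurable_pi_apply i).prodMk (measurable_pi_lambda _ fun j => measurable_pi_apply _)
  have hK : Measurable fun x : Fin (m + 1) → ℝ => hitCount (S (x i)) (i.removeNth x) :=
    (measurable_hitCount_uncurry (m := m) hS).comp hr
  have hg' : Measurable fun x : Fin (m + 1) → ℝ => g (x i) := hg.comp (measurable_pi_apply i)
  have hf : Measurable fun x : Fin (m + 1) → ℝ =>
      ENNReal.ofReal (hitDeviation (S (x i)) (g (x i)) (i.removeNth x)) := by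
    unfold hitDeviation
    fun_prop
  exact hf.indicator (hT.preimage (measurable_pi_apply i))

lemma setLIntegral_sq_scoreError_le (m : ℕ) (a : ℝ) (i : Fin (m + 1)) :
    ∫⁻ x in boundedSamples (m + 1) a, ENNReal.ofReal (scoreError x i ^ 2)
        ∂(Measure.pi fun _ : Fin (m + 1) => gaussianReal 0 1)
      ≤ ENNReal.ofReal (4 * Real.pi / (m + 2)) *
          (2 * ENNReal.ofReal (-Real.log (stdNormalCDF a))) := by
  have hS1 : MeasurableSet {q : ℝ × ℝ | q.2 ∈ Set.Iic q.1} :=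
    measurableSet_le measurable_snd measurable_fst
  have hS2 : MeasurableSet {q : ℝ × ℝ | q.2 ∈ Set.Ioi q.1} :=
    measurableSet_lt measurable_fst measurable_snd
  have hΦ : Measurable stdNormalCDF := continuous_stdNormalCDF.measurable
  let T : Set ℝ := Set.Ioo a (-a)
  let f : (Fin (m + 1) → ℝ) → ENNReal := fun x => T.indicator (fun b =>
    ENNReal.ofReal (hitDeviation (Set.Iic b) (stdNormalCDF b) (i.removeNth x))) (x i)
  let g : (Fin (m + 1) → ℝ) → ENNReal := fun x => T.indicator (fun b =>
    ENNReal.ofReal (hitDeviation (Set.Ioi b) (1 - stdNormalCDF b) (i.removeNth x))) (x i)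
  have h1 := lintegral_sq_div_one_add_hitCount_le (gaussianReal 0 1) (S := Set.Iic) hS1
    (by simpa only [measureReal_Iic_gaussianReal] using hΦ) (T := T) measurableSet_Ioo i
  have h2 := lintegral_sq_div_one_add_hitCount_le (gaussianReal 0 1) (S := Set.Ioi) hS2
    (by simpa only [measureReal_Ioi_gaussianReal] using hΦ.const_sub 1)
    (T := T) measurableSet_Ioo i
  simp only [measureReal_Iic_gaussianReal] at h1
  simp only [measureReal_Ioi_gaussianReal] at h2
  have h1' : ∫⁻ x, f x ∂(Measure.pi fun _ => gaussianReal 0 1) ≤ _ :=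
    h1.trans ((lintegral_mono_set Set.Ioo_subset_Ioi_self).trans
      (lintegral_inv_stdNormalCDF_le a))
  have h2' : ∫⁻ x, g x ∂(Measure.pi fun _ => gaussianReal 0 1) ≤ _ :=
    h2.trans ((lintegral_mono_set Set.Ioo_subset_Iio_self).trans
      (lintegral_inv_one_sub_stdNormalCDF_le a))
  have hf : Measurable f := measurable_indicator_hitDeviation hS1 hΦ measurableSet_Ioo i
  have hle : ∀ x ∈ boundedSamples (m + 1) a, ENNReal.ofReal (scoreError x i ^ 2)
      ≤ ENNReal.ofReal (4 * Real.pi / (m + 2)) * (f x + g x) := by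
    intro x hx
    have hpos := stdNormalCDF_pos (x i)
    have hpos' := sub_pos.2 (stdNormalCDF_lt_one (x i))
    have hc1 := hitCount_nonneg (Set.Iic (x i)) (i.removeNth x)
    have hc2 := hitCount_nonneg (Set.Ioi (x i)) (i.removeNth x)
    simp only [f, g]
    rw [Set.indicator_of_mem (hx i), Set.indicator_of_mem (hx i),
      ← ENNReal.ofReal_add (by unfold hitDeviation; positivity)
        (by unfold hitDeviation; positivity), ← ENNReal.ofReal_mul (by positivity)]
    exact ENNReal.ofReal_le_ofReal (sq_scoreError_le x i)
  calc _ ≤ ∫⁻ x in boundedSamples (m + 1) a, ENNReal.ofReal (4 * Real.pi / (m + 2)) * (f x + g x)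
          ∂(Measure.pi fun _ : Fin (m + 1) => gaussianReal 0 1) :=
        setLIntegral_mono' (measurableSet_boundedSamples _ _) hle
    _ ≤ ∫⁻ x, ENNReal.ofReal (4 * Real.pi / (m + 2)) * (f x + g x)
          ∂(Measure.pi fun _ : Fin (m + 1) => gaussianReal 0 1) := setLIntegral_le_lintegral _ _
    _ = ENNReal.ofReal (4 * Real.pi / (m + 2)) *
          (∫⁻ x, f x ∂(Measure.pi fun _ => gaussianReal 0 1) +
            ∫⁻ x, g x ∂(Measure.pi fun _ => gaussianReal 0 1)) := by
        rw [lintegral_const_mul' _ _ ENNReal.ofReal_ne_top, lintegral_add_left hf]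
    _ ≤ _ := by
        rw [two_mul]
        exact mul_le_mul_right (add_le_add h1' h2') _

lemma setLIntegral_sum_sq_scoreError_le (n : ℕ) (a : ℝ) :
    ∫⁻ x in boundedSamples n a, ENNReal.ofReal (∑ i, scoreError x i ^ 2)
        ∂(Measure.pi fun _ : Fin n => gaussianReal 0 1)
      ≤ ENNReal.ofReal (8 * Real.pi * -Real.log (stdNormalCDF a)) := by
  rcases n with _ | m
  · simp
  have hl : 0 ≤ -Real.log (stdNormalCDF a) :=
    neg_nonneg.2 (Real.log_nonpos (stdNormalCDF_pos a).le (stdNormalCDF_lt_one a).le)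
  simp_rw [ENNReal.ofReal_sum_of_nonneg fun i _ => sq_nonneg _]
  rw [lintegral_finsetSum _ fun i _ => by fun_prop]
  refine (Finset.sum_le_sum fun i _ => setLIntegral_sq_scoreError_le m a i).trans ?_
  rw [Finset.sum_const, Finset.card_univ, Fintype.card_fin, nsmul_eq_mul, ← ENNReal.ofReal_natCast,
    ← ENNReal.ofReal_ofNat 2, ← ENNReal.ofReal_mul (by positivity),
    ← ENNReal.ofReal_mul (by positivity), ← ENNReal.ofReal_mul (by positivity)]
  refine ENNReal.ofReal_le_ofReal ?_
  have e : ((m + 1 : ℕ) : ℝ) * (4 * Real.pi / (m + 2) * (2 * -Real.log (stdNormalCDF a)))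
      = (m + 1) / (m + 2) * (8 * Real.pi * -Real.log (stdNormalCDF a)) := by
    push_cast
    ring
  rw [e]
  refine mul_le_of_le_one_left (by positivity) ?_
  rw [div_le_one (by positivity)]
  linarith

/-! ### Convergence in probability of the error sums -/

/-- The conditional second moment of the cross term, with the score errors frozen as the weights
`d`. Only a centred square-integrable `ζ` is needed, so a degenerate law is allowed. -/
lemma lintegral_sq_sum_mul_eq (ζ : Measure ℝ) [IsProbabilityMeasure ζ] (hζ : MemLp id 2 ζ)
    (h0 : ∫ w, w ∂ζ = 0) {n : ℕ} (d : Fin n → ℝ) :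
    ∫⁻ w : Fin n → ℝ, ENNReal.ofReal ((∑ i, d i * w i) ^ 2) ∂(Measure.pi fun _ => ζ)
      = ENNReal.ofReal (Var[id; ζ]) * ENNReal.ofReal (∑ i, d i ^ 2) := by
  have hL : ∀ i, MemLp (fun w : ℝ => d i * w) 2 ζ := fun i => hζ.const_mul (d i)
  have hLi : ∀ i, MemLp (fun w : Fin n → ℝ => d i * w i) 2 (Measure.pi fun _ => ζ) := fun i =>
    (hL i).comp_measurePreserving (measurePreserving_eval (fun _ : Fin n => ζ) i)
  have hS : MemLp (fun w : Fin n → ℝ => ∑ i, d i * w i) 2 (Measure.pi fun _ => ζ) :=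
    memLp_finsetSum _ fun i _ => hLi i
  have hmean : ∫ w : Fin n → ℝ, ∑ i, d i * w i ∂(Measure.pi fun _ => ζ) = 0 := by
    rw [integral_finsetSum _ fun i _ => (hLi i).integrable one_le_two]
    refine Finset.sum_eq_zero fun i _ => ?_
    have hi : ∫ w : Fin n → ℝ, w i ∂(Measure.pi fun _ => ζ) = ∫ w, w ∂ζ :=
      (measurePreserving_eval (fun _ : Fin n => ζ) i).hasLaw.integral_eq
    rw [integral_const_mul, hi, h0, mul_zero]
  have hvar := variance_sum_pi (μ := fun _ : Fin n => ζ) (X := fun i w => d i * w) hL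
  have hfun : (∑ i, fun w : Fin n → ℝ => d i * w i) = fun w => ∑ i, d i * w i := by
    ext w
    simp
  rw [hfun, variance_of_integral_eq_zero hS.aestronglyMeasurable.aemeasurable hmean] at hvar
  rw [← ofReal_integral_eq_lintegral_ofReal hS.integrable_sq (ae_of_all _ fun w => sq_nonneg _),
    hvar, ← ENNReal.ofReal_mul (variance_nonneg _ _), Finset.mul_sum]
  congr 1
  refine Finset.sum_congr rfl fun i _ => ?_
  rw [variance_const_mul, mul_comm]
  rfl

lemma setLIntegral_sq_sum_scoreError_mul_le (ζ : Measure ℝ) [IsProbabilityMeasure ζ]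
    (hζ : MemLp id 2 ζ) (h0 : ∫ w, w ∂ζ = 0) (n : ℕ) (a : ℝ) :
    ∫⁻ q in boundedSamples n a ×ˢ Set.univ, ENNReal.ofReal ((∑ i, scoreError q.1 i * q.2 i) ^ 2)
        ∂((Measure.pi fun _ : Fin n => gaussianReal 0 1).prod (Measure.pi fun _ : Fin n => ζ))
      ≤ ENNReal.ofReal (Var[id; ζ] * (8 * Real.pi * -Real.log (stdNormalCDF a))) := by
  rw [← Measure.prod_restrict, Measure.restrict_univ, lintegral_prod _ (by fun_prop)]
  simp_rw [lintegral_sq_sum_mul_eq ζ hζ h0]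
  rw [lintegral_const_mul' _ _ ENNReal.ofReal_ne_top, ENNReal.ofReal_mul (variance_nonneg _ _)]
  exact mul_le_mul_right (setLIntegral_sum_sq_scoreError_le n a) _

/-- Markov's inequality on the good event `G`, with a union bound for its complement. -/
lemma measure_le_compl_add_div {E : Type*} [MeasurableSpace E] (μ : Measure E) {f : E → ℝ}
    (hf : Measurable f) {G : Set E} {b c t : ℝ} (hb : 0 ≤ b) (hc : 0 ≤ c)
    (ht : 0 < t) (hμ : μ Gᶜ ≤ ENNReal.ofReal b)
    (hi : ∫⁻ x in G, ENNReal.ofReal (f x) ∂μ ≤ ENNReal.ofReal c) :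
    μ {x | t ≤ f x} ≤ ENNReal.ofReal (b + c / t) := by
  have hm : MeasurableSet {x | t ≤ f x} := measurableSet_le measurable_const hf
  have h1 : μ ({x | t ≤ f x} ∩ G) ≤ ENNReal.ofReal (c / t) := by
    rw [← Measure.restrict_apply hm, ENNReal.ofReal_div_of_pos ht]
    calc _ ≤ μ.restrict G {x | ENNReal.ofReal t ≤ ENNReal.ofReal (f x)} :=
          measure_mono fun x hx => ENNReal.ofReal_le_ofReal hx
      _ ≤ (∫⁻ x in G, ENNReal.ofReal (f x) ∂μ) / ENNReal.ofReal t :=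
          meas_ge_le_lintegral_div (by fun_prop) (ENNReal.ofReal_pos.2 ht).ne'
            ENNReal.ofReal_ne_top
      _ ≤ _ := by gcongr
  calc μ {x | t ≤ f x} ≤ μ (Gᶜ ∪ ({x | t ≤ f x} ∩ G)) := measure_mono fun x hx => by
        by_cases h : x ∈ G
        · exact Or.inr ⟨hx, h⟩
        · exact Or.inl h
    _ ≤ μ Gᶜ + μ ({x | t ≤ f x} ∩ G) := measure_union_le _ _
    _ ≤ ENNReal.ofReal b + ENNReal.ofReal (c / t) := add_le_add hμ h1
    _ = _ := (ENNReal.ofReal_add hb (by positivity)).symm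

lemma exists_truncation {n : ℕ} (hn : 2 ≤ n) : ∃ a, -Real.log (stdNormalCDF a) = 2 * Real.log n ∧
    Measure.pi (fun _ : Fin n => gaussianReal 0 1) (boundedSamples n a)ᶜ
      ≤ ENNReal.ofReal (2 / n) := by
  have hn' : (2 : ℝ) ≤ n := by exact_mod_cast hn
  -- The level `1 / n²` beats the union bound over `n` observations while its logarithm stays of
  -- order `log n`.
  obtain ⟨a, ha⟩ := exists_stdNormalCDF_eq (u := 1 / (n : ℝ) ^ 2) (by positivity)
    (by rw [div_lt_one (by positivity)]; nlinarith)
  refine ⟨a, ?_, (measure_compl_boundedSamples_le n a).trans (le_of_eq ?_)⟩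
  · rw [ha, one_div, Real.log_inv, neg_neg, Real.log_pow]
    norm_num
  · rw [ha]
    congr 1
    field_simp

lemma measure_sum_sq_scoreError_ge_le {n : ℕ} (hn : 2 ≤ n) {t : ℝ} (ht : 0 < t) :
    Measure.pi (fun _ : Fin n => gaussianReal 0 1) {x | t ≤ ∑ i, scoreError x i ^ 2}
      ≤ ENNReal.ofReal (2 / n + 16 * Real.pi * Real.log n / t) := by
  obtain ⟨a, ha, hG⟩ := exists_truncation hn
  have hlog : 0 ≤ Real.log n := Real.log_natCast_nonneg n
  refine measure_le_compl_add_div _ (by fun_prop)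
    (by positivity) (by positivity) ht hG
    ((setLIntegral_sum_sq_scoreError_le n a).trans (le_of_eq ?_))
  rw [ha]
  congr 1
  ring

lemma measure_sq_sum_scoreError_mul_ge_le (ζ : Measure ℝ) [IsProbabilityMeasure ζ]
    (hζ : MemLp id 2 ζ) (h0 : ∫ w, w ∂ζ = 0) {n : ℕ} (hn : 2 ≤ n) {t : ℝ} (ht : 0 < t) :
    ((Measure.pi fun _ : Fin n => gaussianReal 0 1).prod (Measure.pi fun _ : Fin n => ζ))
        {q | t ≤ (∑ i, scoreError q.1 i * q.2 i) ^ 2}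
      ≤ ENNReal.ofReal (2 / n + Var[id; ζ] * (16 * Real.pi * Real.log n) / t) := by
  obtain ⟨a, ha, hG⟩ := exists_truncation hn
  have hlog : 0 ≤ Real.log n := Real.log_natCast_nonneg n
  have hv := variance_nonneg id ζ
  refine measure_le_compl_add_div _ (by fun_prop)
    (by positivity) (by positivity) ht ?_
    ((setLIntegral_sq_sum_scoreError_mul_le ζ hζ h0 n a).trans (le_of_eq ?_))
  · have : (boundedSamples n a ×ˢ (Set.univ : Set (Fin n → ℝ)))ᶜ
        = (boundedSamples n a)ᶜ ×ˢ Set.univ := by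
      ext
      simp
    rw [this, Measure.prod_prod, measure_univ, mul_one]
    exact hG
  · rw [ha]
    congr 1
    ring

lemma tendsto_log_div_sqrt_natCast :
    Tendsto (fun n : ℕ => Real.log n / √(n : ℝ)) atTop (nhds 0) := by
  have h := (isLittleO_log_rpow_atTop (r := 1 / 2) (by norm_num)).tendsto_div_nhds_zero
  simp_rw [← Real.sqrt_eq_rpow] at h
  exact h.comp tendsto_natCast_atTop_atTop

lemma tendsto_log_div_natCast :
    Tendsto (fun n : ℕ => Real.log n / (n : ℝ)) atTop (nhds 0) := by
  have h := Real.isLittleO_log_id_atTop.tendsto_div_nhds_zero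
  exact h.comp tendsto_natCast_atTop_atTop

lemma tendsto_ofReal_two_div_add {g : ℕ → ℝ} (hg : Tendsto g atTop (nhds 0)) (c : ℝ) :
    Tendsto (fun n : ℕ => ENNReal.ofReal (2 / n + c * g n)) atTop (nhds 0) := by
  have h := (tendsto_const_div_atTop_nhds_zero_nat (2 : ℝ)).add (hg.const_mul c)
  rw [mul_zero, add_zero] at h
  have h2 := (ENNReal.continuous_ofReal.tendsto 0).comp h
  rwa [ENNReal.ofReal_zero] at h2

/-! ### Limits in probability along the sample -/

section Sample

variable {Ω : Type*} [MeasurableSpace Ω] {P : Measure Ω}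

lemma tendstoInMeasure_sum_sq_scoreError {X : ℕ → Ω → ℝ}
    (hlaw : ∀ n, HasLaw (fun ω (i : Fin n) => X i ω) (Measure.pi fun _ => gaussianReal 0 1) P) :
    TendstoInMeasure P
      (fun (n : ℕ) ω => 1 / √(n : ℝ) * ∑ i : Fin n, scoreError (fun k : Fin n => X k ω) i ^ 2)
      atTop (fun _ => (0 : ℝ)) := by
  rw [tendstoInMeasure_iff_norm]
  intro ε hε
  refine tendsto_of_tendsto_of_tendsto_of_le_of_le' tendsto_const_nhds
    (tendsto_ofReal_two_div_add tendsto_log_div_sqrt_natCast (16 * Real.pi / ε))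
    (Eventually.of_forall fun _ => zero_le) ?_
  filter_upwards [eventually_ge_atTop 2] with n hn
  have hs : 0 < √(n : ℝ) := Real.sqrt_pos.2 (by positivity)
  have h := measure_sum_sq_scoreError_ge_le hn (mul_pos hε hs)
  rw [← (hlaw n).measure_eq (measurableSet_le measurable_const (by fun_prop))] at h
  refine (measure_mono fun ω hω => ?_).trans (h.trans (le_of_eq ?_))
  · have hnn : 0 ≤ ∑ i : Fin n, scoreError (fun k : Fin n => X k ω) i ^ 2 :=
      Finset.sum_nonneg fun i _ => sq_nonneg _
    rw [Set.mem_ofPred_eq, sub_zero, Real.norm_of_nonneg (by positivity), one_div_mul_eq_div,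
      le_div_iff₀ hs] at hω
    exact hω
  · congr 2
    field_simp

lemma tendstoInMeasure_sum_scoreError_mul {X W : ℕ → Ω → ℝ} (ζ : Measure ℝ)
    [IsProbabilityMeasure ζ] (hζ : MemLp id 2 ζ) (h0 : ∫ w, w ∂ζ = 0)
    (hlaw : ∀ n, HasLaw (fun ω => (fun i : Fin n => X i ω, fun i : Fin n => W i ω))
      ((Measure.pi fun _ => gaussianReal 0 1).prod (Measure.pi fun _ => ζ)) P) :
    TendstoInMeasure P
      (fun (n : ℕ) ω => 1 / √(n : ℝ) *
        ∑ i : Fin n, scoreError (fun k : Fin n => X k ω) i * W i ω)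
      atTop (fun _ => (0 : ℝ)) := by
  rw [tendstoInMeasure_iff_norm]
  intro ε hε
  refine tendsto_of_tendsto_of_tendsto_of_le_of_le' tendsto_const_nhds
    (tendsto_ofReal_two_div_add tendsto_log_div_natCast (Var[id; ζ] * (16 * Real.pi) / ε ^ 2))
    (Eventually.of_forall fun _ => zero_le) ?_
  filter_upwards [eventually_ge_atTop 2] with n hn
  have hn0 : (0 : ℝ) < n := by positivity
  have hs : 0 < √(n : ℝ) := Real.sqrt_pos.2 hn0
  -- The event `ε ≤ |S| / √n` is squared to `ε² n ≤ S²`, so the bound decays like `log n / n`.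
  have h := measure_sq_sum_scoreError_mul_ge_le ζ hζ h0 hn (mul_pos (pow_pos hε 2) hn0)
  rw [← (hlaw n).measure_eq (measurableSet_le measurable_const (by fun_prop))] at h
  refine (measure_mono fun ω hω => ?_).trans (h.trans (le_of_eq ?_))
  · rw [Set.mem_ofPred_eq, sub_zero, norm_mul, Real.norm_of_nonneg (by positivity),
      one_div_mul_eq_div, le_div_iff₀ hs, Real.norm_eq_abs] at hω
    have h2 := pow_le_pow_left₀ (by positivity) hω 2
    rwa [mul_pow, Real.sq_sqrt hn0.le, sq_abs] at h2
  · congr 2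
    field_simp

/-- If every `|u k n ω|` is below `ε / (c * card κ + 1)`, then `|f n ω| < ε`; a union bound
finishes. The `+ 1` keeps the denominator positive when `c` or `card κ` is zero. -/
lemma tendstoInMeasure_zero_of_abs_le_sum {κ : Type*} [Fintype κ] {u : κ → ℕ → Ω → ℝ}
    (hu : ∀ k, TendstoInMeasure P (u k) atTop (fun _ => (0 : ℝ))) {f : ℕ → Ω → ℝ} {c : ℝ}
    (hc : 0 ≤ c) (hf : ∀ n ω, |f n ω| ≤ c * ∑ k, |u k n ω|) :
    TendstoInMeasure P f atTop (fun _ => (0 : ℝ)) := by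
  simp_rw [tendstoInMeasure_iff_norm, sub_zero, Real.norm_eq_abs] at hu ⊢
  intro ε hε
  have hN : (0 : ℝ) < c * Fintype.card κ + 1 := by positivity
  have hδ : 0 < ε / (c * Fintype.card κ + 1) := by positivity
  have hlim := tendsto_finsetSum Finset.univ fun k (_ : k ∈ Finset.univ) => hu k _ hδ
  rw [Finset.sum_const_zero] at hlim
  refine tendsto_of_tendsto_of_tendsto_of_le_of_le tendsto_const_nhds hlim
    (fun _ => zero_le) fun n => ?_
  refine (measure_mono fun ω hω => ?_).trans (measure_iUnion_fintype_le P
    fun k => {ω | ε / (c * Fintype.card κ + 1) ≤ |u k n ω|})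
  by_contra hcon
  simp only [Set.mem_iUnion, Set.mem_ofPred_eq, not_exists, not_le] at hcon hω
  have h1 : ∑ k, |u k n ω| ≤ Fintype.card κ * (ε / (c * Fintype.card κ + 1)) := by
    refine (Finset.sum_le_sum fun k _ => (hcon k).le).trans (le_of_eq ?_)
    rw [Finset.sum_const, Finset.card_univ, nsmul_eq_mul]
  have h2 : ε ≤ c * (Fintype.card κ * (ε / (c * Fintype.card κ + 1))) :=
    hω.trans ((hf n ω).trans (mul_le_mul_of_nonneg_left h1 hc))
  have h3 : ε / (c * Fintype.card κ + 1) * (c * Fintype.card κ + 1) = ε := by field_simp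
  nlinarith

end Sample

/-! ### Gaussian vectors -/

lemma hasLaw_prod_of_covariance_eq_zero {E : Type*} [NormedAddCommGroup E] [NormedSpace ℝ E]
    [MeasurableSpace E] [BorelSpace E] {μ : Measure E} [IsGaussian μ] (K L : StrongDual ℝ E)
    (h : cov[K, L; μ] = 0) :
    HasLaw (fun y => (K y, L y)) ((μ.map K).prod (μ.map L)) μ := by
  have hK : HasLaw K (μ.map K) μ := ⟨by fun_prop, rfl⟩
  have hL : HasLaw L (μ.map L) μ := ⟨by fun_prop, rfl⟩
  refine (indepFun_iff_hasLaw_prodMk_prod hK hL).1 ?_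
  exact HasGaussianLaw.indepFun_of_covariance_eq_zero
    (IsGaussian.hasGaussianLaw_id.map (K.prod L)) h

/-- Independence within each pair, together with independence across observations, makes one whole
column independent of the other. -/
lemma HasLaw.pi_prodMk {Ω E F : Type*} [MeasurableSpace Ω] [MeasurableSpace E] [MeasurableSpace F]
    {P : Measure Ω} {ι : Type*} [Fintype ι] {X : ι → Ω → E} {W : ι → Ω → F} {ν : Measure E}
    {ζ : Measure F} [SigmaFinite ν] [SigmaFinite ζ]
    (hind : iIndepFun (fun i ω => (X i ω, W i ω)) P)
    (hlaw : ∀ i, HasLaw (fun ω => (X i ω, W i ω)) (ν.prod ζ) P) :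
    HasLaw (fun ω => (fun i => X i ω, fun i => W i ω))
      ((Measure.pi fun _ => ν).prod (Measure.pi fun _ => ζ)) P :=
  (measurePreserving_arrowProdEquivProdArrow E F ι (fun _ => ν) (fun _ => ζ)).comp_hasLaw
    (hind.hasLaw_pi hlaw)

/-! ### The quadratic form of the normal scores -/

lemma quadForm_sub_quadForm {p : ℕ} (A : Matrix (Fin p) (Fin p) ℝ) (v y : Fin p → ℝ) :
    quadForm A v - quadForm A y
      = quadForm A (v - y) + (v - y) ⬝ᵥ ((A + Aᵀ) *ᵥ y) := by
  have h : v ⬝ᵥ Aᵀ *ᵥ y = y ⬝ᵥ A *ᵥ v := by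
    rw [Matrix.dotProduct_mulVec, Matrix.vecMul_transpose, dotProduct_comm]
  have h' : y ⬝ᵥ Aᵀ *ᵥ y = y ⬝ᵥ A *ᵥ y := by
    rw [Matrix.dotProduct_mulVec, Matrix.vecMul_transpose, dotProduct_comm]
  simp only [quadForm, Matrix.add_mulVec, Matrix.mulVec_sub, dotProduct_add, dotProduct_sub,
    sub_dotProduct, h, h']
  ring

lemma abs_quadForm_le {p : ℕ} (A : Matrix (Fin p) (Fin p) ℝ) (v : Fin p → ℝ) :
    |quadForm A v| ≤ (∑ j, ∑ k, |A j k|) * ∑ j, v j ^ 2 := by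
  have hv : ∀ j, v j ^ 2 ≤ ∑ j, v j ^ 2 := fun j =>
    Finset.single_le_sum (f := fun j => v j ^ 2) (fun _ _ => sq_nonneg _) (Finset.mem_univ j)
  have hterm : ∀ j k, |v j * (A j k * v k)| ≤ |A j k| * ∑ j, v j ^ 2 := fun j k => by
    rw [abs_mul, abs_mul, mul_left_comm]
    refine mul_le_mul_of_nonneg_left ?_ (abs_nonneg _)
    have := hv j
    have := hv k
    nlinarith [sq_nonneg (|v j| - |v k|), sq_abs (v j), sq_abs (v k)]
  have e : quadForm A v = ∑ j, ∑ k, v j * (A j k * v k) := by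
    simp only [quadForm, dotProduct, Matrix.mulVec, Finset.mul_sum]
  rw [e, Finset.sum_mul]
  refine (Finset.abs_sum_le_sum_abs _ _).trans (Finset.sum_le_sum fun j _ => ?_)
  rw [Finset.sum_mul]
  exact (Finset.abs_sum_le_sum_abs _ _).trans (Finset.sum_le_sum fun k _ => hterm j k)

/-- The linear functional `y ↦ (M y)_j`. -/
noncomputable def rowFunctional {p : ℕ} (M : Matrix (Fin p) (Fin p) ℝ) (j : Fin p) :
    StrongDual ℝ (EuclideanSpace ℝ (Fin p)) :=
  ∑ k, M j k • EuclideanSpace.proj k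

lemma rowFunctional_apply {p : ℕ} (M : Matrix (Fin p) (Fin p) ℝ) (j : Fin p)
    (y : EuclideanSpace ℝ (Fin p)) : rowFunctional M j y = (M *ᵥ y) j := by
  simp [rowFunctional, Matrix.mulVec, dotProduct]

/-- With `M = A + Aᵀ` the right-hand side is the diagonal entry that the hypothesis on `A`
annihilates. -/
lemma covariance_proj_rowFunctional {p : ℕ} {C : Matrix (Fin p) (Fin p) ℝ} (hC : C.PosSemidef)
    (M : Matrix (Fin p) (Fin p) ℝ) (j : Fin p) :
    cov[(EuclideanSpace.proj j : StrongDual ℝ (EuclideanSpace ℝ (Fin p))), rowFunctional M j;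
      multivariateGaussian 0 C] = (M * C) j j := by
  have hLp : ∀ k, MemLp (fun y : EuclideanSpace ℝ (Fin p) => y k) 2 (multivariateGaussian 0 C) :=
    fun k => (IsGaussian.hasGaussianLaw_id.map
      (EuclideanSpace.proj k : StrongDual ℝ (EuclideanSpace ℝ (Fin p)))).memLp_two
  have hrow : ⇑(rowFunctional M j) = fun y => ∑ k, M j k * y k := by
    ext y
    simp [rowFunctional]
  rw [hrow, Matrix.mul_apply]
  refine (covariance_fun_sum_right (X := fun k (y : EuclideanSpace ℝ (Fin p)) => M j k * y k)
    (fun k => (hLp k).const_mul _) (hLp j)).trans ?_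
  refine Finset.sum_congr rfl fun k _ => ?_
  rw [covariance_const_mul_right]
  congr 1
  refine (covariance_eval_multivariateGaussian hC j k).trans ?_
  simpa using hC.isHermitian.apply k j

lemma hasLaw_proj_rowFunctional {p : ℕ} {C : Matrix (Fin p) (Fin p) ℝ}
    (hC : IsCorrelationMatrix C) {M : Matrix (Fin p) (Fin p) ℝ} {j : Fin p}
    (hM : (M * C) j j = 0) :
    HasLaw (fun y : EuclideanSpace ℝ (Fin p) => (y j, rowFunctional M j y))
      ((gaussianReal 0 1).prod ((multivariateGaussian 0 C).map (rowFunctional M j)))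
      (multivariateGaussian 0 C) := by
  have h := hasLaw_prod_of_covariance_eq_zero (μ := multivariateGaussian 0 C)
    (EuclideanSpace.proj j) (rowFunctional M j)
    ((covariance_proj_rowFunctional hC.1 M j).trans hM)
  have hmap : (multivariateGaussian 0 C).map
      (EuclideanSpace.proj j : StrongDual ℝ (EuclideanSpace ℝ (Fin p))) = gaussianReal 0 1 := by
    have := (measurePreserving_eval_multivariateGaussian (μ := 0) hC.1 (i := j)).map_eq
    rwa [hC.2 j, Real.toNNReal_one] at this
  rwa [hmap] at h

/-- Regroups the cross term by columns, since independence is available only within a column. The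
constant is one more than the sum of the `|A j k|` so that it dominates the coefficients of both
sums. -/
lemma abs_scoreQuadDiff_le {Ω : Type*} {p : ℕ} (A : Matrix (Fin p) (Fin p) ℝ)
    (Y : ℕ → Ω → EuclideanSpace ℝ (Fin p)) (n : ℕ) (ω : Ω) :
    |scoreQuadDiff A Y n ω| ≤ ((∑ j, ∑ k, |A j k|) + 1) *
      ((∑ j, |1 / √(n : ℝ) * ∑ i : Fin n, scoreError (fun k : Fin n => Y k ω j) i ^ 2|) +
        ∑ j, |1 / √(n : ℝ) * ∑ i : Fin n, scoreError (fun k : Fin n => Y k ω j) i *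
          rowFunctional (A + Aᵀ) j (Y i ω)|) := by
  set α := ∑ j, ∑ k, |A j k|
  have hα : 0 ≤ α := Finset.sum_nonneg fun j _ => Finset.sum_nonneg fun k _ => abs_nonneg _
  have hs : 0 ≤ 1 / √(n : ℝ) := by positivity
  set s := 1 / √(n : ℝ)
  let D : Fin n → Fin p → ℝ := fun i j => scoreError (fun k : Fin n => Y k ω j) i
  have hD : ∀ i, normalScores (dataMatrix Y n ω) i - dataMatrix Y n ω i = D i := fun i => rfl
  have hsplit : scoreQuadDiff A Y n ω = s * ∑ i, quadForm A (D i) +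
      ∑ j, s * ∑ i, D i j * rowFunctional (A + Aᵀ) j (Y i ω) := by
    simp_rw [scoreQuadDiff, quadForm_sub_quadForm, hD, Finset.sum_add_distrib, mul_add]
    congr 1
    rw [← Finset.mul_sum, Finset.sum_comm]
    simp only [rowFunctional_apply]
    rfl
  have hquad : |s * ∑ i, quadForm A (D i)| ≤ α * ∑ j, |s * ∑ i, D i j ^ 2| := by
    have hnn : ∀ j, |s * ∑ i, D i j ^ 2| = s * ∑ i, D i j ^ 2 := fun j =>
      abs_of_nonneg (mul_nonneg hs (Finset.sum_nonneg fun i _ => sq_nonneg _))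
    simp_rw [hnn]
    rw [abs_mul, abs_of_nonneg hs, ← Finset.mul_sum, Finset.sum_comm, mul_left_comm]
    refine mul_le_mul_of_nonneg_left ?_ hs
    rw [Finset.mul_sum]
    exact (Finset.abs_sum_le_sum_abs _ _).trans
      (Finset.sum_le_sum fun i _ => abs_quadForm_le A (D i))
  have hlin := Finset.abs_sum_le_sum_abs
    (fun j => s * ∑ i, D i j * rowFunctional (A + Aᵀ) j (Y i ω)) Finset.univ
  have h1 : 0 ≤ ∑ j, |s * ∑ i, D i j ^ 2| := Finset.sum_nonneg fun j _ => abs_nonneg _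
  have h2 : 0 ≤ ∑ j, |s * ∑ i, D i j * rowFunctional (A + Aᵀ) j (Y i ω)| :=
    Finset.sum_nonneg fun j _ => abs_nonneg _
  rw [hsplit]
  calc _ ≤ α * (∑ j, |s * ∑ i, D i j ^ 2|) +
        ∑ j, |s * ∑ i, D i j * rowFunctional (A + Aᵀ) j (Y i ω)| :=
        (abs_add_le _ _).trans (add_le_add hquad hlin)
    _ ≤ (α + 1) * ((∑ j, |s * ∑ i, D i j ^ 2|) +
        ∑ j, |s * ∑ i, D i j * rowFunctional (A + Aᵀ) j (Y i ω)|) := by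
        nlinarith [mul_nonneg hα h2]

theorem theorem2 {Ω : Type*} [MeasurableSpace Ω] (P : Measure Ω) [IsProbabilityMeasure P]
    {p : ℕ} (C : Matrix (Fin p) (Fin p) ℝ) (hC : IsCorrelationMatrix C)
    (Y : ℕ → Ω → EuclideanSpace ℝ (Fin p))
    (hindep : iIndepFun Y P)
    (hlaw : ∀ i, HasLaw (Y i) (multivariateGaussian 0 C) P)
    (A : Matrix (Fin p) (Fin p) ℝ)
    (hA : Matrix.diag (A * C + Aᵀ * C) = 0) :
    TendstoInMeasure P (scoreQuadDiff A Y) atTop (fun _ => (0 : ℝ)) := by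
  have hM : ∀ j, ((A + Aᵀ) * C) j j = 0 := fun j => by
    rw [Matrix.add_mul]
    exact congrFun hA j
  have hprob : ∀ j, IsProbabilityMeasure
      ((multivariateGaussian 0 C).map (rowFunctional (A + Aᵀ) j)) := fun j =>
    Measure.isProbabilityMeasure_map (by fun_prop)
  have hpair : ∀ j (n : ℕ), HasLaw (fun ω => (fun i : Fin n => Y i ω j,
      fun i : Fin n => rowFunctional (A + Aᵀ) j (Y i ω)))
      ((Measure.pi fun _ => gaussianReal 0 1).prod
        (Measure.pi fun _ => (multivariateGaussian 0 C).map (rowFunctional (A + Aᵀ) j))) P := by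
    intro j n
    refine HasLaw.pi_prodMk ?_ fun i => (hasLaw_proj_rowFunctional hC (hM j)).fun_comp (hlaw i)
    exact (hindep.comp (fun _ y => (y j, rowFunctional (A + Aᵀ) j y))
      fun _ => by fun_prop).precomp Fin.val_injective
  have hX : ∀ j (n : ℕ), HasLaw (fun ω (i : Fin n) => Y i ω j)
      (Measure.pi fun _ => gaussianReal 0 1) P := fun j n =>
    measurePreserving_fst.fun_comp_hasLaw (hpair j n)
  have hgauss : ∀ j, HasGaussianLaw (rowFunctional (A + Aᵀ) j) (multivariateGaussian 0 C) :=
    fun j => IsGaussian.hasGaussianLaw_id.map (rowFunctional (A + Aᵀ) j)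
  have hLp : ∀ j, MemLp id 2 ((multivariateGaussian 0 C).map (rowFunctional (A + Aᵀ) j)) :=
    fun j => (hgauss j).isGaussian_map.memLp_two_id
  have hmean : ∀ j, ∫ w, w ∂((multivariateGaussian 0 C).map (rowFunctional (A + Aᵀ) j)) = 0 := by
    intro j
    rw [ContinuousLinearMap.integral_id_map IsGaussian.integrable_id,
      integral_id_multivariateGaussian, map_zero]
  have hsq := fun j => tendstoInMeasure_sum_sq_scoreError (X := fun i ω => Y i ω j) (hX j)
  have hlin := fun j => tendstoInMeasure_sum_scoreError_mul (X := fun i ω => Y i ω j)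
    (W := fun i ω => rowFunctional (A + Aᵀ) j (Y i ω)) _ (hLp j) (hmean j) (hpair j)
  -- The index type is doubled: the left copy carries the squared errors, the right copy the cross
  -- terms.
  refine tendstoInMeasure_zero_of_abs_le_sum (κ := Fin p ⊕ Fin p)
    (u := Sum.elim
      (fun j n ω => 1 / √(n : ℝ) * ∑ i : Fin n, scoreError (fun k : Fin n => Y k ω j) i ^ 2)
      (fun j n ω => 1 / √(n : ℝ) * ∑ i : Fin n, scoreError (fun k : Fin n => Y k ω j) i *
        rowFunctional (A + Aᵀ) j (Y i ω)))
    (c := (∑ j, ∑ k, |A j k|) + 1) ?_ ?_ fun n ω => ?_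
  · rintro (j | j)
    · exact hsq j
    · exact hlin j
  · positivity
  · rw [Fintype.sum_sum_type]
    exact abs_scoreQuadDiff_le A Y n ω
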